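/- Let $\mathcal H=(\mathcal V,\mathcal E,\omega,\gamma)$ be a finite hypergraph with edge-dependent vertex weights: $\mathcal V$ is a finite set with at least two elements, $\mathcal E\subseteq 2^{\mathcal V}$ is a set of nonempty hyperedges, $\omega(e)>0$ for $e\in\mathcal E$, and $\gamma_e(v)\ge 0$ with $\gamma_e(v)>0$ if and only if $v\in e$. Assume that $\mathcal H$ is connected (any two vertices are joined by a chain of vertices in which consecutive vertices share a hyperedge). Put $d(u)=\sum_{e\ni u}\omega(e)$, $\delta(e)=\sum_{v\in e}\gamma_e(v)$, and let $P$ be the transition matrix of the hypergraph random walk, $P_{u,v}=\sum_{e\ni u}\frac{\omega(e)}{d(u)}\frac{\gamma_e(v)}{\delta(e)}$ (i.e. $P=D_{\mathcal V}^{-1}WD_{\mathcal E}^{-1}R$), with stationary distribution $\phi$ ($\phi P=\phi$, $\phi>0$, $\sum_u\phi(u)=1$). For $S\subseteq\mathcal V$ let $vol(S)=\sum_{u\in S}\phi(u)$, $|\partial S|=\sum_{u\in S,\,v\notin S}\phi(u)P_{u,v}$ and, for $\emptyset\ne S\ne\mathcal V$, $\Phi(S)=|\partial S|/\min(vol(S),1-vol(S))$.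 For every $S\subsetneq\mathcal V$ let $S^*$ be the set of minimum conductance among the nonempty proper vertex sets containing $S$ (if the minimum is attained by several sets, $S^*$ is the one chosen by an arbitrary tie-breaking rule, which is fixed and used for all seed sets). Consider the following two conditions on $S\subsetneq\mathcal V$: (1) $vol(S^*)\le\frac12$; (2) $S^*$ is also the set of optimal conductance for the seed set $S^*\setminus S$, i.e. $(S^*\setminus S)^*=S^*$. Consider the algorithm HyperACL with seed set $S$ and restart probability $\alpha$: compute the lazy PageRank vector $p$ given by $p=\alpha\psi_S+(1-\alpha)\,p\,\frac{I+P}{2}$, where $\psi_S(v)=\phi(v)/vol(S)$ for $v\in S$ and $\psi_S(v)=0$ otherwise; order the support of $p$ as $v_1,\dots,v_N$ with $p(v_i)/\phi(v_i)$ non-increasing; return a set $S'$ of smallest conductance among the sets $\{v_1,\dots,v_j\}\ne\mathcal V$, $1\le j\le N$. (On $S=\emptyset$, where $\psi_S$ is not defined, the algorithm counts as failing.) Then there is an absolute constant $K>0$ such that, for every such hypergraph and every tie-breaking rule, if $S$ is a uniformly random subset of $\mathcal V$, then, conditionally on (1) and (2) (provided that these hold with positive probability), with probability at least $\frac12$ HyperACL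 run on $S$ with $\alpha=\Phi(S^*)$ returns a set and, however ties in the ordering and in the final minimum are broken, the set $S'$ returned satisfies $$\Phi(S')<K\sqrt{\Phi(S^*)}.$$ -/

import Mathlib

open scoped Matrix

/-- A hypergraph with edge-dependent vertex weights on a finite vertex set `V`: a set of (nonempty)
hyperedges, a positive weight `ω e` on every hyperedge, and for every hyperedge `e` nonnegative
vertex weights `γ e v`, positive exactly when `v ∈ e`. -/
structure EDVWHypergraph (V : Type*) [Fintype V] [DecidableEq V] where
  edges : Finset (Finset V)
  edge_nonempty : ∀ e ∈ edges, e.Nonempty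
  ω : Finset V → ℝ
  γ : Finset V → V → ℝ
  ω_pos : ∀ e ∈ edges, 0 < ω e
  γ_nonneg : ∀ e ∈ edges, ∀ v, 0 ≤ γ e v
  γ_pos_iff : ∀ e ∈ edges, ∀ v, 0 < γ e v ↔ v ∈ e

noncomputable section

namespace EDVWHypergraph

variable {V : Type*} [Fintype V] [DecidableEq V] (H : EDVWHypergraph V)

/-- The hyperedges incident to `v`. -/
def incident (v : V) : Finset (Finset V) := H.edges.filter (fun e => v ∈ e)

/-- The degree `d(v)` of a vertex: total weight of the incident hyperedges. -/
def vertexDegree (v : V) : ℝ := ∑ e ∈ H.incident v, H.ω e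

/-- The degree `δ(e)` of a hyperedge: total edge-dependent weight of its vertices. -/
def edgeDegree (e : Finset V) : ℝ := ∑ v ∈ e, H.γ e v

/-- Any two vertices are joined by a chain of vertices, consecutive ones sharing a hyperedge. -/
def Connected : Prop :=
  ∀ u v : V, Relation.ReflTransGen (fun a b => ∃ e ∈ H.edges, a ∈ e ∧ b ∈ e) u v

/-- Transition matrix of the random walk: from `u` choose an incident hyperedge `e` with
probability `ω(e)/d(u)`, then a vertex `v` of `e` with probability `γ_e(v)/δ(e)`. -/
def transition : Matrix V V ℝ :=
  Matrix.of fun u v =>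
    ∑ e ∈ H.incident u, H.ω e / H.vertexDegree u * (H.γ e v / H.edgeDegree e)

/-- Vertex-weight matrix `R`. -/
def vertexWeightMatrix : Matrix H.edges V ℝ := Matrix.of fun e v => H.γ e v

/-- Hyperedge-weight matrix `W`. -/
def edgeWeightMatrix : Matrix V H.edges ℝ :=
  Matrix.of fun v e => if v ∈ (e : Finset V) then H.ω e else 0

theorem edgeDegree_pos {e : Finset V} (he : e ∈ H.edges) : 0 < H.edgeDegree e :=
  Finset.sum_pos (fun v hv => (H.γ_pos_iff e he v).2 hv) (H.edge_nonempty e he)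

/-- If every vertex lies in some hyperedge, the transition matrix is `D_V⁻¹ W D_E⁻¹ R`. -/
theorem transition_eq_mul (hd : ∀ v, (H.incident v).Nonempty) :
    H.transition =
      (Matrix.diagonal H.vertexDegree)⁻¹ * H.edgeWeightMatrix *
        (Matrix.diagonal fun e : H.edges => H.edgeDegree e)⁻¹ * H.vertexWeightMatrix := by
  have hV : (Matrix.diagonal H.vertexDegree)⁻¹ =
      Matrix.diagonal fun v => (H.vertexDegree v)⁻¹ := by
    refine Matrix.inv_eq_right_inv ?_
    rw [Matrix.diagonal_mul_diagonal, ← Matrix.diagonal_one]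
    congr 1
    funext v
    refine mul_inv_cancel₀ (ne_of_gt (Finset.sum_pos (fun e he => ?_) (hd v)))
    exact H.ω_pos e (Finset.mem_filter.1 he).1
  have hE : (Matrix.diagonal fun e : H.edges => H.edgeDegree e)⁻¹ =
      Matrix.diagonal fun e : H.edges => (H.edgeDegree e)⁻¹ := by
    refine Matrix.inv_eq_right_inv ?_
    rw [Matrix.diagonal_mul_diagonal, ← Matrix.diagonal_one]
    congr 1
    funext e
    exact mul_inv_cancel₀ (H.edgeDegree_pos e.2).ne'
  ext u v
  rw [hV, hE, Matrix.mul_apply]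
  simp only [transition, incident, Matrix.of_apply, Matrix.mul_diagonal, Matrix.diagonal_mul,
    edgeWeightMatrix, vertexWeightMatrix, Finset.sum_filter]
  rw [← Finset.sum_coe_sort H.edges]
  refine Finset.sum_congr rfl fun e _ => ?_
  split_ifs <;> simp [div_eq_mul_inv]; ring

/-- `φ` is a stationary distribution of the random walk: `φ P = φ`, `φ > 0`, total mass one. -/
def IsStationary (φ : V → ℝ) : Prop :=
  φ ᵥ* H.transition = φ ∧ (∀ u, 0 < φ u) ∧ ∑ u, φ u = 1

/-- Volume of a vertex set. -/
def vol (φ : V → ℝ) (S : Finset V) : ℝ := ∑ u ∈ S, φ u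

/-- Volume `|∂S|` of the boundary: stationary probability flow from `S` to its complement. -/
def boundary (φ : V → ℝ) (S : Finset V) : ℝ := ∑ u ∈ S, ∑ v ∈ Sᶜ, φ u * H.transition u v

/-- Conductance `Φ(S) = |∂S| / min (vol S, 1 - vol S)`, meaningful for `∅ ≠ S ≠ V`. -/
def conductance (φ : V → ℝ) (S : Finset V) : ℝ :=
  H.boundary φ S / min (vol φ S) (1 - vol φ S)

/-- `C` has optimal conductance among the vertex sets (nonempty, proper) containing `S`. -/
def IsOptimalCluster (φ : V → ℝ) (S C : Finset V) : Prop :=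
  S ⊆ C ∧ C.Nonempty ∧ C ≠ Finset.univ ∧
    ∀ D : Finset V, S ⊆ D → D.Nonempty → D ≠ Finset.univ →
      H.conductance φ C ≤ H.conductance φ D

/-- Starting distribution `ψ_S`: `φ` conditioned on `S`. -/
def startDist (φ : V → ℝ) (S : Finset V) (v : V) : ℝ := if v ∈ S then φ v / vol φ S else 0

/-- Lazy random walk matrix `M = (I + P) / 2`. -/
def lazyTransition : Matrix V V ℝ := (1 / 2 : ℝ) • (1 + H.transition)

/-- `p` is the lazy PageRank vector `pr(α, s)`, i.e. it solves `p = α s + (1 - α) p M`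
(for `0 < α ≤ 1` the solution is unique). -/
def IsLazyPageRank (α : ℝ) (s p : V → ℝ) : Prop :=
  p = α • s + (1 - α) • (p ᵥ* H.lazyTransition)

/-- `l` lists the support of `p` in non-increasing order of `p(v) / φ(v)`. -/
def IsSweepOrder (φ p : V → ℝ) (l : List V) : Prop :=
  l.Nodup ∧ (∀ v, v ∈ l ↔ 0 < p v) ∧ l.Pairwise (fun u v => p v / φ v ≤ p u / φ u)

/-- The sweep cuts of a sweep order `v₁, …, v_N`: the sets `{v₁, …, v_j}`, `1 ≤ j ≤ N`,
different from the whole vertex set. -/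
def IsSweepCut (l : List V) (T : Finset V) : Prop :=
  T ≠ Finset.univ ∧ ∃ j, 1 ≤ j ∧ j ≤ l.length ∧ T = (l.take j).toFinset

/-- `T` is a possible output of HyperACL on seed set `S` with restart probability `α`:
compute `p = pr(α, ψ_S)`, sort the support of `p` by `p(v)/φ(v)` (ties broken in any way), and return
a sweep cut of smallest conductance (ties broken in any way). -/
def IsHyperACLOutput (φ : V → ℝ) (α : ℝ) (S T : Finset V) : Prop :=
  ∃ (p : V → ℝ) (l : List V), H.IsLazyPageRank α (startDist φ S) p ∧ IsSweepOrder φ p l ∧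
    IsSweepCut l T ∧ ∀ T', IsSweepCut l T' → H.conductance φ T ≤ H.conductance φ T'

/-- Conditions (1) and (2) on a seed set `S`, where `star A` denotes the chosen optimal
cluster for the seed set `A`: it exists (`S ≠ V`), `vol (star S) ≤ 1/2`, and `star S` is also the
optimal cluster for the seed set `star S \ S`. -/
def SeedCondition (φ : V → ℝ) (star : Finset V → Finset V) (S : Finset V) : Prop :=
  S ≠ Finset.univ ∧ vol φ (star S) ≤ 1 / 2 ∧ star (star S \ S) = star S

/-- On the seed set `S` with `α = Φ(star S)`, HyperACL returns a cluster, and whatever the tie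
breaking, its conductance is less than `K √Φ(star S)`. -/
def HyperACLSucceeds (φ : V → ℝ) (star : Finset V → Finset V) (K : ℝ) (S : Finset V) : Prop :=
  (∃ T, H.IsHyperACLOutput φ (H.conductance φ (star S)) S T) ∧
    ∀ T, H.IsHyperACLOutput φ (H.conductance φ (star S)) S T →
      H.conductance φ T < K * √(H.conductance φ (star S))

end EDVWHypergraph

open Classical in
/-- Probability of an event for a uniformly random subset of `V`. -/
def uniformSubsetProb (V : Type*) [Fintype V] (A : Finset V → Prop) : ℝ :=
  ((Finset.univ.filter A).card : ℝ) / (Fintype.card (Finset V) : ℝ)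

end

/-! ### PageRank for a general row-stochastic matrix. -/

section StochasticMatrix

variable {V : Type*} [Fintype V] {M : Matrix V V ℝ}

/-! Conditions (1) and (2) make `S ↦ star S \ S` an involution on the admissible seed sets: the two
members of a pair are complementary parts of one cluster `C`. It therefore suffices that at least
one part of each pair succeeds (`hyperACLSucceeds_or`), for then failures inject into successes
(`half_le_uniformSubsetProb_div`).

For a pair `A`, `B`, the distribution `ψ_C` is the average of `ψ_A` and `ψ_B` with weights
proportional to volume, and PageRank is linear in its start. Started from `ψ_C` with `α = Φ(C)`,
PageRank keeps mass at least `1/2 + 1/512` in `C` (`half_lt_sum_pageRank`). Hence one part has a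
constant fraction of `vol C` and its own PageRank keeps at least `1/2 + 1/1024` in `C`.

For that part a Lovász–Simonovits argument applies. If all sweep cuts had conductance at least `2 ^
26 * √α`, PageRank would be almost mixed (`sum_pageRank_le`), with mass at most `vol C + 2 * 2⁻¹² ≤
1/2 + 1/2048` in `C`, a contradiction. No logarithmic factor appears: the seed has volume comparable
to `C`, which bounds the density `p / φ` by a constant over `vol C`. -/

theorem sum_vecMul_of_row_sum_eq_one (hM1 : ∀ u, ∑ v, M u v = 1) (x : V → ℝ) :
    ∑ v, (x ᵥ* M) v = ∑ v, x v := by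
  simp only [Matrix.vecMul, dotProduct]
  rw [Finset.sum_comm]
  simp [← Finset.mul_sum, hM1]

theorem vecMul_nonneg_of_nonneg (hM0 : ∀ u v, 0 ≤ M u v) {x : V → ℝ} (hx : ∀ v, 0 ≤ x v) (v : V) :
    0 ≤ (x ᵥ* M) v :=
  Finset.sum_nonneg fun u _ => mul_nonneg (hx u) (hM0 u v)

/-- The negative part `n` of `p` satisfies `n ≤ (1 - α) n M` entrywise. As `M` preserves total mass,
the mass of `n` must vanish. Applied to differences, this also yields uniqueness and comparison of
PageRank vectors. -/
theorem pageRank_nonneg (hM0 : ∀ u v, 0 ≤ M u v) (hM1 : ∀ u, ∑ v, M u v = 1) {α : ℝ}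
    (hα : 0 < α) (hα1 : α ≤ 1) {s p : V → ℝ} (hs : ∀ v, 0 ≤ s v)
    (hp : p = α • s + (1 - α) • (p ᵥ* M)) (v : V) : 0 ≤ p v := by
  set n : V → ℝ := fun v => max (-p v) 0 with hn
  have hn0 : ∀ v, 0 ≤ n v := fun v => le_max_right _ _
  have hle : ∀ v, n v ≤ (1 - α) * (n ᵥ* M) v := by
    intro v
    have h0 : 0 ≤ (1 - α) * (n ᵥ* M) v :=
      mul_nonneg (by linarith) (vecMul_nonneg_of_nonneg hM0 hn0 v)
    refine max_le ?_ h0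
    have h1 : p v = α * s v + (1 - α) * (p ᵥ* M) v := by
      simpa using congrFun hp v
    have h2 : 0 ≤ ((p + n) ᵥ* M) v := by
      refine vecMul_nonneg_of_nonneg hM0 (fun u => ?_) v
      have : -p u ≤ n u := le_max_left _ _
      simp only [Pi.add_apply]; linarith
    rw [Matrix.add_vecMul] at h2
    simp only [Pi.add_apply] at h2
    have h3 := mul_nonneg hα.le (hs v)
    nlinarith [mul_nonneg (by linarith : 0 ≤ 1 - α) h2]
  have hsum : ∑ v, n v ≤ (1 - α) * ∑ v, n v := by
    conv_rhs => rw [← sum_vecMul_of_row_sum_eq_one hM1 n, Finset.mul_sum]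
    exact Finset.sum_le_sum fun v _ => hle v
  have hz : ∑ v, n v = 0 :=
    le_antisymm (by nlinarith) (Finset.sum_nonneg fun v _ => hn0 v)
  have h4 := (Finset.sum_eq_zero_iff_of_nonneg fun v _ => hn0 v).1 hz v (Finset.mem_univ v)
  have h5 : -p v ≤ n v := le_max_left _ _
  linarith

theorem sum_pageRank (hM1 : ∀ u, ∑ v, M u v = 1) {α : ℝ} (hα : 0 < α) {s p : V → ℝ}
    (hp : p = α • s + (1 - α) • (p ᵥ* M)) : ∑ v, p v = ∑ v, s v := by
  have h : ∑ v, p v = α * ∑ v, s v + (1 - α) * ∑ v, p v := by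
    conv_lhs => rw [hp]
    simp only [Pi.add_apply, Pi.smul_apply, smul_eq_mul, Finset.sum_add_distrib, ← Finset.mul_sum,
      sum_vecMul_of_row_sum_eq_one hM1]
  have : α * (∑ v, p v - ∑ v, s v) = 0 := by linarith
  rcases mul_eq_zero.1 this with h | h <;> linarith

theorem pageRank_unique (hM0 : ∀ u v, 0 ≤ M u v) (hM1 : ∀ u, ∑ v, M u v = 1) {α : ℝ}
    (hα : 0 < α) (hα1 : α ≤ 1) {s p q : V → ℝ} (hp : p = α • s + (1 - α) • (p ᵥ* M))
    (hq : q = α • s + (1 - α) • (q ᵥ* M)) : p = q := by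
  have key : ∀ x y : V → ℝ, x = α • s + (1 - α) • (x ᵥ* M) → y = α • s + (1 - α) • (y ᵥ* M) →
      ∀ v, 0 ≤ (x - y) v := fun x y hx hy =>
    pageRank_nonneg hM0 hM1 hα hα1 (s := 0) (fun _ => le_rfl) (by
      rw [Matrix.sub_vecMul]
      conv_lhs => rw [hx, hy]
      module)
  funext v
  exact le_antisymm (sub_nonneg.1 (key q p hq hp v)) (sub_nonneg.1 (key p q hp hq v))

theorem exists_pageRank [DecidableEq V] (hM0 : ∀ u v, 0 ≤ M u v) (hM1 : ∀ u, ∑ v, M u v = 1)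
    {α : ℝ} (hα : 0 < α) (hα1 : α ≤ 1) (s : V → ℝ) :
    ∃ p : V → ℝ, p = α • s + (1 - α) • (p ᵥ* M) := by
  let T : (V → ℝ) →ₗ[ℝ] (V → ℝ) := LinearMap.id - (1 - α) • M.vecMulLinear
  have hT : ∀ p, T p = p - (1 - α) • (p ᵥ* M) := fun p => rfl
  have hinj : Function.Injective T := by
    rw [← LinearMap.ker_eq_bot, LinearMap.ker_eq_bot']
    intro p hp
    rw [hT, sub_eq_zero] at hp
    exact pageRank_unique hM0 hM1 hα hα1 (s := 0) (by simpa using hp) (by simp)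
  obtain ⟨p, hp⟩ := (LinearMap.injective_iff_surjective.1 hinj) (α • s)
  exact ⟨p, by rw [hT] at hp; rw [← hp]; abel⟩

end StochasticMatrix

/-! ### The hypergraph walk: stationary flow, conductance and start distributions. -/

namespace EDVWHypergraph

variable {V : Type*} [Fintype V] [DecidableEq V] (H : EDVWHypergraph V)

theorem vertexDegree_nonneg (u : V) : 0 ≤ H.vertexDegree u :=
  Finset.sum_nonneg fun e he => (H.ω_pos e (Finset.mem_filter.1 he).1).le

theorem transition_term_nonneg (u v : V) {e : Finset V} (he : e ∈ H.incident u) :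
    0 ≤ H.ω e / H.vertexDegree u * (H.γ e v / H.edgeDegree e) := by
  have h := (Finset.mem_filter.1 he).1
  exact mul_nonneg (div_nonneg (H.ω_pos e h).le (H.vertexDegree_nonneg u))
    (div_nonneg (H.γ_nonneg e h v) (H.edgeDegree_pos h).le)

theorem transition_nonneg (u v : V) : 0 ≤ H.transition u v :=
  Finset.sum_nonneg fun _ he => H.transition_term_nonneg u v he

theorem transition_pos {u v : V} {e : Finset V} (he : e ∈ H.edges) (hu : u ∈ e) (hv : v ∈ e) :
    0 < H.transition u v := by
  have hi : e ∈ H.incident u := Finset.mem_filter.2 ⟨he, hu⟩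
  have hd : 0 < H.vertexDegree u :=
    Finset.sum_pos (fun e he => H.ω_pos e (Finset.mem_filter.1 he).1) ⟨e, hi⟩
  refine Finset.sum_pos' (fun e he => H.transition_term_nonneg u v he) ⟨e, hi, ?_⟩
  exact mul_pos (div_pos (H.ω_pos e he) hd)
    (div_pos ((H.γ_pos_iff e he v).2 hv) (H.edgeDegree_pos he))

theorem Connected.incident_nonempty {H : EDVWHypergraph V} [Nontrivial V] (hc : H.Connected)
    (v : V) : (H.incident v).Nonempty := by
  obtain ⟨u, hu⟩ := exists_ne v
  rcases Relation.ReflTransGen.cases_head (hc v u) with h | ⟨w, ⟨e, he, hv, _⟩, _⟩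
  · exact absurd h.symm hu
  · exact ⟨e, Finset.mem_filter.2 ⟨he, hv⟩⟩

theorem sum_transition (hd : ∀ v, (H.incident v).Nonempty) (u : V) :
    ∑ v, H.transition u v = 1 := by
  simp only [transition, Matrix.of_apply]
  rw [Finset.sum_comm]
  have h1 : ∀ e ∈ H.incident u,
      ∑ v, H.ω e / H.vertexDegree u * (H.γ e v / H.edgeDegree e) = H.ω e / H.vertexDegree u := by
    intro e he
    have hE := (Finset.mem_filter.1 he).1
    have hsum : ∑ v, H.γ e v = H.edgeDegree e := by
      refine (Finset.sum_subset (Finset.subset_univ e) fun v _ hv => ?_).symm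
      exact le_antisymm (not_lt.1 fun h => hv ((H.γ_pos_iff e hE v).1 h)) (H.γ_nonneg e hE v)
    rw [← Finset.mul_sum, ← Finset.sum_div, hsum, div_self (H.edgeDegree_pos hE).ne', mul_one]
  rw [Finset.sum_congr rfl h1, ← Finset.sum_div]
  refine div_self (ne_of_gt (Finset.sum_pos (fun e he => ?_) (hd u)))
  exact H.ω_pos e (Finset.mem_filter.1 he).1

theorem lazyTransition_apply (u v : V) :
    H.lazyTransition u v = (1 / 2) * ((1 : Matrix V V ℝ) u v + H.transition u v) := by
  simp [lazyTransition]

theorem lazyTransition_nonneg (u v : V) : 0 ≤ H.lazyTransition u v := by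
  rw [lazyTransition_apply, Matrix.one_apply]
  have := H.transition_nonneg u v
  split_ifs <;> linarith

theorem sum_lazyTransition (hd : ∀ v, (H.incident v).Nonempty) (u : V) :
    ∑ v, H.lazyTransition u v = 1 := by
  simp only [lazyTransition_apply]
  rw [← Finset.mul_sum, Finset.sum_add_distrib, H.sum_transition hd]
  simp [Matrix.one_apply]
  norm_num

theorem vecMul_lazyTransition (x : V → ℝ) (v : V) :
    (x ᵥ* H.lazyTransition) v = (1 / 2) * (x v + (x ᵥ* H.transition) v) := by
  rw [lazyTransition, Matrix.vecMul_smul, Matrix.vecMul_add, Matrix.vecMul_one]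
  simp

variable {H} {φ : V → ℝ}

theorem IsStationary.vecMul_lazyTransition (hφ : H.IsStationary φ) :
    φ ᵥ* H.lazyTransition = φ := by
  funext v
  rw [EDVWHypergraph.vecMul_lazyTransition, hφ.1]
  ring

theorem IsStationary.vol_nonneg (hφ : H.IsStationary φ) (S : Finset V) : 0 ≤ vol φ S :=
  Finset.sum_nonneg fun v _ => (hφ.2.1 v).le

theorem IsStationary.vol_pos (hφ : H.IsStationary φ) {S : Finset V} (hS : S.Nonempty) :
    0 < vol φ S :=
  Finset.sum_pos (fun v _ => hφ.2.1 v) hS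

theorem IsStationary.vol_compl (hφ : H.IsStationary φ) (S : Finset V) :
    vol φ Sᶜ = 1 - vol φ S := by
  have := Finset.sum_add_sum_compl S φ
  rw [hφ.2.2] at this
  simp only [vol]
  linarith

theorem IsStationary.vol_lt_one (hφ : H.IsStationary φ) {S : Finset V} (hS : S ≠ Finset.univ) :
    vol φ S < 1 := by
  have h := hφ.vol_pos (S := Sᶜ) (by
    rw [Finset.nonempty_iff_ne_empty]
    simpa [Finset.compl_eq_empty_iff] using hS)
  rw [hφ.vol_compl] at h
  linarith

theorem IsStationary.boundary_pos (hφ : H.IsStationary φ) (hc : H.Connected) {S : Finset V}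
    (hS : S.Nonempty) (hS' : S ≠ Finset.univ) : 0 < H.boundary φ S := by
  obtain ⟨u, hu⟩ := hS
  obtain ⟨v, hv⟩ : ∃ v, v ∉ S := by
    by_contra! h
    exact hS' (Finset.eq_univ_iff_forall.2 h)
  obtain ⟨a, ha, b, hb, e, he, hae, hbe⟩ :
      ∃ a ∈ S, ∃ b, b ∉ S ∧ ∃ e ∈ H.edges, a ∈ e ∧ b ∈ e := by
    by_contra! h
    have key : ∀ w, Relation.ReflTransGen (fun a b => ∃ e ∈ H.edges, a ∈ e ∧ b ∈ e) u w →
        w ∈ S := by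
      intro w hw
      induction hw with
      | refl => exact hu
      | tail _ hbc ih =>
        obtain ⟨e, he, h1, h2⟩ := hbc
        by_contra hcS
        exact h _ ih _ hcS e he h1 h2
    exact hv (key v (hc u v))
  have h0 : ∀ u v, 0 ≤ φ u * H.transition u v := fun u v =>
    mul_nonneg (hφ.2.1 u).le (H.transition_nonneg u v)
  refine Finset.sum_pos' (fun u _ => Finset.sum_nonneg fun v _ => h0 u v) ⟨a, ha, ?_⟩
  refine Finset.sum_pos' (fun v _ => h0 a v) ⟨b, Finset.mem_compl.2 hb, ?_⟩
  exact mul_pos (hφ.2.1 a) (H.transition_pos he hae hbe)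

theorem sum_sum_eq_vol_sub_boundary (hd : ∀ v, (H.incident v).Nonempty) (S : Finset V) :
    ∑ u ∈ S, ∑ v ∈ S, φ u * H.transition u v = vol φ S - H.boundary φ S := by
  rw [eq_sub_iff_add_eq, boundary, ← Finset.sum_add_distrib, vol]
  refine Finset.sum_congr rfl fun u _ => ?_
  rw [Finset.sum_add_sum_compl, ← Finset.mul_sum, H.sum_transition hd, mul_one]

/-- In the stationary regime the flow into a set equals the flow out of it. -/
theorem IsStationary.sum_compl_eq_boundary (hφ : H.IsStationary φ)
    (hd : ∀ v, (H.incident v).Nonempty) (S : Finset V) :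
    ∑ u ∈ Sᶜ, ∑ v ∈ S, φ u * H.transition u v = H.boundary φ S := by
  have h1 := sum_sum_eq_vol_sub_boundary (φ := φ) hd S
  have h2 : ∑ u ∈ S, ∑ v ∈ S, φ u * H.transition u v +
      ∑ u ∈ Sᶜ, ∑ v ∈ S, φ u * H.transition u v = vol φ S := by
    rw [Finset.sum_add_sum_compl, Finset.sum_comm]
    exact Finset.sum_congr rfl fun v _ => congrFun hφ.1 v
  linarith

theorem IsStationary.boundary_le (hφ : H.IsStationary φ) (hd : ∀ v, (H.incident v).Nonempty)
    (S : Finset V) : H.boundary φ S ≤ min (vol φ S) (1 - vol φ S) := by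
  have h0 : ∀ u v, 0 ≤ φ u * H.transition u v := fun u v =>
    mul_nonneg (hφ.2.1 u).le (H.transition_nonneg u v)
  refine le_min ?_ ?_
  · have h1 := sum_sum_eq_vol_sub_boundary (φ := φ) hd S
    have h2 : 0 ≤ ∑ u ∈ S, ∑ v ∈ S, φ u * H.transition u v :=
      Finset.sum_nonneg fun u _ => Finset.sum_nonneg fun v _ => h0 u v
    linarith
  · rw [← hφ.sum_compl_eq_boundary hd, ← hφ.vol_compl, vol]
    refine Finset.sum_le_sum fun u _ => ?_
    calc ∑ v ∈ S, φ u * H.transition u v ≤ ∑ v, φ u * H.transition u v :=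
          Finset.sum_le_sum_of_subset_of_nonneg (Finset.subset_univ _) fun v _ _ => h0 u v
      _ = φ u := by rw [← Finset.mul_sum, H.sum_transition hd, mul_one]

theorem IsStationary.min_vol_pos (hφ : H.IsStationary φ) {S : Finset V}
    (hS : S.Nonempty) (hS' : S ≠ Finset.univ) : 0 < min (vol φ S) (1 - vol φ S) :=
  lt_min (hφ.vol_pos hS) (by linarith [hφ.vol_lt_one hS'])

theorem IsStationary.conductance_pos (hφ : H.IsStationary φ) (hc : H.Connected) {S : Finset V}
    (hS : S.Nonempty) (hS' : S ≠ Finset.univ) : 0 < H.conductance φ S :=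
  div_pos (hφ.boundary_pos hc hS hS') (hφ.min_vol_pos hS hS')

theorem IsStationary.conductance_le_one (hφ : H.IsStationary φ)
    (hd : ∀ v, (H.incident v).Nonempty) {S : Finset V}
    (hS : S.Nonempty) (hS' : S ≠ Finset.univ) : H.conductance φ S ≤ 1 :=
  (div_le_one (hφ.min_vol_pos hS hS')).2 (hφ.boundary_le hd S)

theorem IsStationary.startDist_nonneg (hφ : H.IsStationary φ) (S : Finset V) (v : V) :
    0 ≤ startDist φ S v := by
  rw [startDist]
  split_ifs
  · exact div_nonneg (hφ.2.1 v).le (hφ.vol_nonneg S)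
  · exact le_rfl

theorem IsStationary.startDist_le (hφ : H.IsStationary φ) (S : Finset V) (v : V) :
    startDist φ S v ≤ φ v / vol φ S := by
  rw [startDist]
  split_ifs
  · exact le_rfl
  · exact div_nonneg (hφ.2.1 v).le (hφ.vol_nonneg S)

theorem IsStationary.sum_startDist_of_subset (hφ : H.IsStationary φ) {S T : Finset V}
    (hS : S.Nonempty) (hST : S ⊆ T) : ∑ v ∈ T, startDist φ S v = 1 := by
  simp only [startDist]
  rw [Finset.sum_ite_mem, Finset.inter_eq_right.2 hST, ← Finset.sum_div]
  exact div_self (hφ.vol_pos hS).ne'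

/-- By stationarity `φ / vol S` is its own PageRank, and it dominates `ψ_S`, so the difference is
the PageRank of a nonnegative vector. -/
theorem IsStationary.pageRank_le (hφ : H.IsStationary φ) (hd : ∀ v, (H.incident v).Nonempty)
    {α : ℝ} (hα : 0 < α) (hα1 : α ≤ 1) {S : Finset V} {p : V → ℝ}
    (hp : H.IsLazyPageRank α (startDist φ S) p) (v : V) : p v ≤ φ v / vol φ S := by
  have h := pageRank_nonneg H.lazyTransition_nonneg (H.sum_lazyTransition hd) hα hα1
    (s := (vol φ S)⁻¹ • φ - startDist φ S) (p := (vol φ S)⁻¹ • φ - p)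
    (fun v => by
      have := hφ.startDist_le S v
      simp only [Pi.sub_apply, Pi.smul_apply, smul_eq_mul]
      rw [div_eq_inv_mul] at this
      linarith)
    (by
      rw [Matrix.sub_vecMul, Matrix.smul_vecMul, hφ.vecMul_lazyTransition]
      conv_lhs => rw [hp]
      module) v
  simp only [Pi.sub_apply, Pi.smul_apply, smul_eq_mul] at h
  rw [div_eq_inv_mul]
  linarith

end EDVWHypergraph

/-! ### Quantitative concavity and superlevel sets. -/

theorem sqrt_sub_add_sqrt_add_le {x δ : ℝ} (hx : 0 < x) (hδ : 0 ≤ δ) (hδx : δ ≤ x) :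
    √(x - δ) + √(x + δ) ≤ 2 * (√x * (1 - (δ / x) ^ 2 / 8)) := by
  set a := δ / x with ha
  have ha0 : 0 ≤ a := by positivity
  have ha1 : a ≤ 1 := (div_le_one hx).2 hδx
  have hδa : δ = x * a := by rw [ha]; field_simp
  have h1 : x - δ = x * (1 - a) := by rw [hδa]; ring
  have h2 : x + δ = x * (1 + a) := by rw [hδa]; ring
  rw [h1, h2, Real.sqrt_mul hx.le, Real.sqrt_mul hx.le]
  have hA := Real.sq_sqrt (by linarith : 0 ≤ 1 - a)
  have hB := Real.sq_sqrt (by linarith : 0 ≤ 1 + a)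
  -- The product is `√(1 - a²)`; it is the cross term when the sum of the two roots is squared.
  have hAB : √(1 - a) * √(1 + a) ≤ 1 - a ^ 2 / 2 := by
    rw [← Real.sqrt_mul (by linarith)]
    refine Real.sqrt_le_iff.2 ⟨by nlinarith, ?_⟩
    nlinarith [sq_nonneg (a ^ 2)]
  have hs : √(1 - a) + √(1 + a) ≤ 2 * (1 - a ^ 2 / 8) := by
    refine abs_le_of_sq_le_sq' ?_ (by nlinarith) |>.2
    nlinarith [sq_nonneg (a ^ 2)]
  nlinarith [mul_le_mul_of_nonneg_left hs (Real.sqrt_nonneg x)]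

theorem concaveOn_add_mul_sqrt (ε : ℝ) {ν : ℝ} (hν : 0 ≤ ν) :
    ConcaveOn ℝ (Set.Icc 0 1) fun x : ℝ => x + ε + ν * √x := by
  have h1 : ConcaveOn ℝ (Set.Icc (0 : ℝ) 1) fun x => ν * √x :=
    ((Real.strictConcaveOn_sqrt.concaveOn).subset Set.Icc_subset_Ici_self (convex_Icc 0 1)).smul hν
  exact ((concaveOn_id (convex_Icc 0 1)).add_const ε).add h1

section UpperLevel

variable {V : Type*} [Fintype V] [DecidableEq V]

/-- `T` is a superlevel set of `r`. -/
def IsUpperLevel (r : V → ℝ) (T : Finset V) : Prop := ∀ u ∈ T, ∀ v, v ∉ T → r v < r u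

/-- A concave bound on the mass of the superlevel sets of `r` extends to all fractional sets. -/
theorem sum_mul_le_of_isUpperLevel {φ r : V → ℝ} (hφ0 : ∀ v, 0 < φ v) (hφ1 : ∑ v, φ v = 1)
    {g : ℝ → ℝ} (hg : ConcaveOn ℝ (Set.Icc 0 1) g) {m : ℝ}
    (hm : ∀ T, IsUpperLevel r T → ∑ v ∈ T, r v * φ v ≤ g (∑ v ∈ T, φ v) + m)
    {c : V → ℝ} (hc0 : ∀ v, 0 ≤ c v) (hcφ : ∀ v, c v ≤ φ v) :
    ∑ v, r v * c v ≤ g (∑ v, c v) + m := by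
  classical
  set X := ∑ v, c v with hX
  have hX0 : 0 ≤ X := Finset.sum_nonneg fun v _ => hc0 v
  -- `T` is the largest superlevel set of weight at most `X`. Adding the next level `D` overshoots
  -- `X`, so `X` lies between two consecutive breakpoints `x` and `y`.
  obtain ⟨T, hT, hmax⟩ := Finset.exists_max_image
    (Finset.univ.filter fun T : Finset V => IsUpperLevel r T ∧ ∑ v ∈ T, φ v ≤ X) Finset.card
    ⟨∅, Finset.mem_filter.2 ⟨Finset.mem_univ _, by simp [IsUpperLevel], by simpa using hX0⟩⟩
  obtain ⟨hTu, hTX⟩ := (Finset.mem_filter.1 hT).2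
  by_cases hTuniv : T = Finset.univ
  · subst hTuniv
    have hle : X ≤ ∑ v, φ v := Finset.sum_le_sum fun v _ => hcφ v
    have heq : ∑ v, c v = ∑ v, φ v := le_antisymm hle hTX
    have hcv := (Finset.sum_eq_sum_iff_of_le fun v _ => hcφ v).1 heq
    have h := hm _ hTu
    rw [← heq] at h
    rw [Finset.sum_congr rfl fun v hv => by rw [hcv v hv]]
    exact h
  obtain ⟨w, hw, hwmax⟩ := Finset.exists_max_image Tᶜ r (by
    rw [Finset.nonempty_iff_ne_empty]
    simpa [Finset.compl_eq_empty_iff] using hTuniv)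
  rw [Finset.mem_compl] at hw
  set D : Finset V := Tᶜ.filter fun v => r v = r w with hD
  have hdisj : Disjoint T D := by
    rw [Finset.disjoint_left]
    intro v hv hvD
    exact Finset.mem_compl.1 (Finset.mem_filter.1 hvD).1 hv
  have hT'u : IsUpperLevel r (T ∪ D) := by
    intro u hu v hv
    simp only [Finset.mem_union, not_or, hD, Finset.mem_filter, Finset.mem_compl] at hu hv
    rcases hu with hu | hu
    · exact hTu u hu v hv.1
    · rw [hu.2]
      exact lt_of_le_of_ne (hwmax v (Finset.mem_compl.2 hv.1)) fun h => hv.2 ⟨hv.1, h⟩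
  have hXT' : X < ∑ v ∈ T ∪ D, φ v := by
    by_contra! h
    have h1 := hmax _ (Finset.mem_filter.2 ⟨Finset.mem_univ _, hT'u, h⟩)
    have h2 : w ∈ D := Finset.mem_filter.2 ⟨Finset.mem_compl.2 hw, rfl⟩
    rw [Finset.card_union_of_disjoint hdisj] at h1
    have := Finset.card_pos.2 ⟨w, h2⟩
    omega
  set x := ∑ v ∈ T, φ v with hx
  set y := ∑ v ∈ T ∪ D, φ v with hy
  have hyx : y = x + ∑ v ∈ D, φ v := Finset.sum_union hdisj
  have hpy : ∑ v ∈ T ∪ D, r v * φ v = ∑ v ∈ T, r v * φ v + r w * (y - x) := by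
    rw [Finset.sum_union hdisj, hyx, add_sub_cancel_left, Finset.mul_sum]
    congr 1
    exact Finset.sum_congr rfl fun v hv => by rw [(Finset.mem_filter.1 hv).2]
  -- Among fractional sets of weight `X`, filling `T` and then part of level `D` is optimal. This
  -- bound is linear in `X` between the breakpoints, where the chord of `g` lies below `g`.
  have hrc : ∑ v, r v * c v ≤ ∑ v ∈ T, r v * φ v + r w * (X - x) := by
    have h1 : ∑ v, (r v - r w) * c v ≤ ∑ v ∈ T, (r v - r w) * φ v := by
      rw [← Finset.sum_add_sum_compl T]
      have h2 : ∑ v ∈ Tᶜ, (r v - r w) * c v ≤ 0 := Finset.sum_nonpos fun v hv =>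
        mul_nonpos_of_nonpos_of_nonneg (by linarith [hwmax v hv]) (hc0 v)
      have h3 : ∑ v ∈ T, (r v - r w) * c v ≤ ∑ v ∈ T, (r v - r w) * φ v :=
        Finset.sum_le_sum fun v hv =>
          mul_le_mul_of_nonneg_left (hcφ v) (by linarith [hTu v hv w hw])
      linarith
    simp only [sub_mul, Finset.sum_sub_distrib, ← Finset.mul_sum] at h1
    linarith
  have hyle : y ≤ 1 := by
    rw [← hφ1]
    exact Finset.sum_le_sum_of_subset_of_nonneg (Finset.subset_univ _) fun v _ _ => (hφ0 v).le
  have hx0 : 0 ≤ x := Finset.sum_nonneg fun v _ => (hφ0 v).le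
  have hxy : 0 < y - x := by linarith
  have hgX := hg.2 (show x ∈ Set.Icc (0 : ℝ) 1 from ⟨hx0, by linarith⟩)
    (show y ∈ Set.Icc (0 : ℝ) 1 from ⟨by linarith, hyle⟩)
    (show 0 ≤ (y - X) / (y - x) from div_nonneg (by linarith) hxy.le)
    (show 0 ≤ (X - x) / (y - x) from div_nonneg (by linarith) hxy.le)
    (by rw [← add_div]; exact (div_eq_one_iff_eq hxy.ne').2 (by ring))
  have hXeq : ((y - X) / (y - x)) • x + ((X - x) / (y - x)) • y = X := by
    simp only [smul_eq_mul]
    field_simp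
    ring
  rw [hXeq] at hgX
  simp only [smul_eq_mul] at hgX
  have e1 := hm T hTu
  have e2 := hm _ hT'u
  rw [hpy] at e2
  have e3 : (y - x) * g X ≥ (y - X) * g x + (X - x) * g y := by
    have := mul_le_mul_of_nonneg_left hgX hxy.le
    have h4 : (y - x) * ((y - X) / (y - x) * g x + (X - x) / (y - x) * g y) =
        (y - X) * g x + (X - x) * g y := by field_simp
    linarith
  have e4 : (y - x) * (∑ v ∈ T, r v * φ v + r w * (X - x)) ≤ (y - x) * (g X + m) := by
    nlinarith [mul_le_mul_of_nonneg_left e1 (by linarith : 0 ≤ y - X),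
      mul_le_mul_of_nonneg_left e2 (by linarith : 0 ≤ X - x)]
  exact hrc.trans (le_of_mul_le_mul_left e4 hxy)

end UpperLevel

/-! ### Lovász–Simonovits mixing bound. -/

namespace EDVWHypergraph

variable {V : Type*} [Fintype V] [DecidableEq V] {H : EDVWHypergraph V} {φ : V → ℝ}

/-- One step of the lazy walk, as an average of the density `p / φ` over two fractional sets of
total weights `vol T ∓ |∂T|`. -/
theorem IsStationary.sum_vecMul_lazyTransition (hφ : H.IsStationary φ) (p : V → ℝ) (T : Finset V) :
    ∑ v ∈ T, (p ᵥ* H.lazyTransition) v =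
      (1 / 2) * (∑ u, p u / φ u * (if u ∈ T then ∑ v ∈ T, φ u * H.transition u v else 0) +
        ∑ u, p u / φ u * (if u ∈ T then φ u else ∑ v ∈ T, φ u * H.transition u v)) := by
  simp only [EDVWHypergraph.vecMul_lazyTransition]
  have hT : ∑ v ∈ T, p v = ∑ u, if u ∈ T then p u else 0 := by
    rw [Finset.sum_ite_mem, Finset.univ_inter]
  rw [← Finset.mul_sum, Finset.sum_add_distrib]
  congr 1
  have hM : ∀ v, (p ᵥ* H.transition) v = ∑ u, p u * H.transition u v := fun v => rfl
  simp only [hM]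
  rw [Finset.sum_comm, hT, ← Finset.sum_add_distrib, ← Finset.sum_add_distrib]
  refine Finset.sum_congr rfl fun u _ => ?_
  have hu := (hφ.2.1 u).ne'
  split_ifs
  · rw [← Finset.mul_sum, ← Finset.mul_sum]; field_simp; ring
  · rw [← Finset.mul_sum, ← Finset.mul_sum]; field_simp; ring

/-- PageRank is a fixed point, so no iteration in time is needed. At a superlevel set of maximal
excess over `g`, one lazy step loses a definite amount through the strict concavity of `√`, while
the restart returns at most `α`; by `hνα` the loss is larger, so no excess can be positive. -/
theorem IsStationary.sum_pageRank_le_of_isUpperLevel (hφ : H.IsStationary φ)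
    (hd : ∀ v, (H.incident v).Nonempty) {α κ ε ν : ℝ} (hα : 0 < α) (hα1 : α ≤ 1)
    (hκ : 0 ≤ κ) (hε : 0 < ε) (hε1 : ε ≤ 1) (hν : 0 ≤ ν) {S : Finset V} (hS : S.Nonempty)
    {p : V → ℝ} (hp : H.IsLazyPageRank α (startDist φ S) p)
    (hνα : 8 * α < ν * (κ * ε) ^ 2 * √(ε * vol φ S))
    (hcond : ∀ T, IsUpperLevel (fun v => p v / φ v) T → T.Nonempty → T ≠ Finset.univ →
      κ * min (vol φ T) (1 - vol φ T) ≤ H.boundary φ T)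
    {T : Finset V} (hT : IsUpperLevel (fun v => p v / φ v) T) :
    ∑ v ∈ T, p v ≤ vol φ T + ε + ν * √(vol φ T) := by
  classical
  set r : V → ℝ := fun v => p v / φ v with hr
  set g : ℝ → ℝ := fun x => x + ε + ν * √x with hg
  have hp0 : ∀ v, 0 ≤ p v := pageRank_nonneg H.lazyTransition_nonneg (H.sum_lazyTransition hd)
    hα hα1 (hφ.startDist_nonneg S) hp
  have hS1 : ∑ v, startDist φ S v = 1 :=
    hφ.sum_startDist_of_subset hS (Finset.subset_univ _)
  have hp1 : ∑ v, p v = 1 := (sum_pageRank (H.sum_lazyTransition hd) hα hp).trans hS1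
  have hrφ : ∀ T : Finset V, ∑ v ∈ T, r v * φ v = ∑ v ∈ T, p v := fun T =>
    Finset.sum_congr rfl fun v _ => div_mul_cancel₀ _ (hφ.2.1 v).ne'
  obtain ⟨A, hA, hmax⟩ := Finset.exists_max_image
    (Finset.univ.filter fun T : Finset V => IsUpperLevel r T)
    (fun T => ∑ v ∈ T, p v - g (vol φ T)) ⟨T, by simpa using hT⟩
  have hAu := (Finset.mem_filter.1 hA).2
  by_contra! hlt
  have hgA : g (vol φ A) < ∑ v ∈ A, p v := by
    have h1 := hmax T (by simpa using hT)
    have h2 : g (vol φ T) < ∑ v ∈ T, p v := hlt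
    linarith
  set x := vol φ A with hx
  have hvS := hφ.vol_pos hS
  have hx0 : 0 ≤ x := hφ.vol_nonneg A
  have hsq : 0 ≤ ν * √x := mul_nonneg hν (Real.sqrt_nonneg _)
  have hgA' : x + ε + ν * √x < ∑ v ∈ A, p v := hgA
  have hA0 : A.Nonempty := by
    rw [Finset.nonempty_iff_ne_empty]
    rintro rfl
    simp only [Finset.sum_empty] at hgA'
    linarith
  have hpA1 : ∑ v ∈ A, p v ≤ 1 := by
    rw [← hp1]
    exact Finset.sum_le_sum_of_subset_of_nonneg (Finset.subset_univ _) fun v _ _ => hp0 v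
  have hx1 : x + ε < 1 := by linarith
  have hA1 : A ≠ Finset.univ := by
    rintro rfl
    have : x = 1 := hφ.2.2
    linarith
  have hxpos : 0 < x := hφ.vol_pos hA0
  have hpAx : ∑ v ∈ A, p v ≤ x / vol φ S := by
    rw [hx, vol, Finset.sum_div]
    exact Finset.sum_le_sum fun v _ => hφ.pageRank_le hd hα hα1 hp v
  have hxS : ε * vol φ S < x := by
    rw [← lt_div_iff₀ hvS]
    linarith
  set δ := H.boundary φ A with hδ
  have hδle : δ ≤ min x (1 - x) := hφ.boundary_le hd A
  have hδx : δ ≤ x := hδle.trans (min_le_left _ _)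
  have hδge : κ * ε * x ≤ δ := by
    -- Both `x` and `1 - x` are at least `ε * x`, since `ε ≤ 1` and `ε < 1 - x`.
    refine le_trans ?_ (hcond A hAu hA0 hA1)
    rw [mul_assoc]
    refine mul_le_mul_of_nonneg_left (le_min ?_ ?_) hκ <;> nlinarith
  have hδ0 : 0 ≤ δ := le_trans (by positivity) hδge
  have hconc : ConcaveOn ℝ (Set.Icc 0 1) g := concaveOn_add_mul_sqrt ε hν
  have hP0 : ∀ u v, 0 ≤ φ u * H.transition u v := fun u v =>
    mul_nonneg (hφ.2.1 u).le (H.transition_nonneg u v)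
  have hPle : ∀ u, ∑ v ∈ A, φ u * H.transition u v ≤ φ u := fun u => by
    calc ∑ v ∈ A, φ u * H.transition u v ≤ ∑ v, φ u * H.transition u v :=
          Finset.sum_le_sum_of_subset_of_nonneg (Finset.subset_univ _) fun v _ _ => hP0 u v
      _ = φ u := by rw [← Finset.mul_sum, H.sum_transition hd, mul_one]
  have hPge : ∀ u, 0 ≤ ∑ v ∈ A, φ u * H.transition u v := fun u =>
    Finset.sum_nonneg fun v _ => hP0 u v
  have hbound : ∀ T, IsUpperLevel r T → ∑ v ∈ T, r v * φ v ≤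
      g (∑ v ∈ T, φ v) + (∑ v ∈ A, p v - g x) := fun T hT => by
    have h1 := hmax T (by simpa using hT)
    rw [hrφ]
    simp only [vol] at h1
    linarith
  have key1 := sum_mul_le_of_isUpperLevel hφ.2.1 hφ.2.2 hconc hbound
    (c := fun u => if u ∈ A then ∑ v ∈ A, φ u * H.transition u v else 0)
    (fun u => by split_ifs <;> simp [hPge])
    (fun u => by split_ifs <;> simp [hPle, (hφ.2.1 u).le])
  have key2 := sum_mul_le_of_isUpperLevel hφ.2.1 hφ.2.2 hconc hbound
    (c := fun u => if u ∈ A then φ u else ∑ v ∈ A, φ u * H.transition u v)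
    (fun u => by split_ifs <;> simp [hPge, (hφ.2.1 u).le])
    (fun u => by split_ifs <;> simp [hPle])
  have hc1 : ∑ u, (if u ∈ A then ∑ v ∈ A, φ u * H.transition u v else 0) = x - δ := by
    rw [Finset.sum_ite_mem, Finset.univ_inter]
    exact sum_sum_eq_vol_sub_boundary hd A
  have hc2 : ∑ u, (if u ∈ A then φ u else ∑ v ∈ A, φ u * H.transition u v) = x + δ := by
    rw [← Finset.sum_add_sum_compl A, hδ, ← hφ.sum_compl_eq_boundary hd A, hx, vol]
    congr 1
    · exact Finset.sum_congr rfl fun u hu => if_pos hu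
    · exact Finset.sum_congr rfl fun u hu => if_neg (Finset.mem_compl.1 hu)
  rw [hc1] at key1
  rw [hc2] at key2
  have hstep := hφ.sum_vecMul_lazyTransition p A
  have hpA : ∑ v ∈ A, p v = α * ∑ v ∈ A, startDist φ S v +
      (1 - α) * ∑ v ∈ A, (p ᵥ* H.lazyTransition) v := by
    conv_lhs => rw [hp]
    simp only [Pi.add_apply, Pi.smul_apply, smul_eq_mul, Finset.sum_add_distrib, ← Finset.mul_sum]
  have hsA : ∑ v ∈ A, startDist φ S v ≤ 1 := by
    rw [← hS1]
    exact Finset.sum_le_sum_of_subset_of_nonneg (Finset.subset_univ _)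
      fun v _ _ => hφ.startDist_nonneg S v
  have hM0 : 0 ≤ ∑ v ∈ A, (p ᵥ* H.lazyTransition) v :=
    Finset.sum_nonneg fun v _ => vecMul_nonneg_of_nonneg H.lazyTransition_nonneg hp0 v
  have hsqrt := sqrt_sub_add_sqrt_add_le hxpos hδ0 hδx
  have hq : (κ * ε) ^ 2 ≤ (δ / x) ^ 2 := by
    refine pow_le_pow_left₀ (by positivity) ?_ 2
    rwa [le_div_iff₀ hxpos]
  have hs : √(ε * vol φ S) ≤ √x := Real.sqrt_le_sqrt hxS.le
  have hfin : ν * (κ * ε) ^ 2 * √(ε * vol φ S) ≤ ν * (δ / x) ^ 2 * √x := by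
    gcongr
  have hν2 := mul_le_mul_of_nonneg_left hsqrt hν
  simp only [hg, hr] at key1 key2
  nlinarith [mul_le_mul_of_nonneg_left hsA hα.le, mul_nonneg hα.le hM0]

/-- If all level sets of the PageRank density have large conductance, then PageRank is mixed. -/
theorem IsStationary.sum_pageRank_le (hφ : H.IsStationary φ)
    (hd : ∀ v, (H.incident v).Nonempty) {α κ ε ν : ℝ} (hα : 0 < α) (hα1 : α ≤ 1)
    (hκ : 0 ≤ κ) (hε : 0 < ε) (hε1 : ε ≤ 1) (hν : 0 ≤ ν) {S : Finset V} (hS : S.Nonempty)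
    {p : V → ℝ} (hp : H.IsLazyPageRank α (startDist φ S) p)
    (hνα : 8 * α < ν * (κ * ε) ^ 2 * √(ε * vol φ S))
    (hcond : ∀ T, IsUpperLevel (fun v => p v / φ v) T → T.Nonempty → T ≠ Finset.univ →
      κ * min (vol φ T) (1 - vol φ T) ≤ H.boundary φ T) (T : Finset V) :
    ∑ v ∈ T, p v ≤ vol φ T + ε + ν * √(vol φ T) := by
  have hrφ : ∀ v, p v / φ v * φ v = p v := fun v => div_mul_cancel₀ _ (hφ.2.1 v).ne'
  have h := sum_mul_le_of_isUpperLevel hφ.2.1 hφ.2.2 (concaveOn_add_mul_sqrt ε hν)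
    (r := fun v => p v / φ v) (m := 0) (fun A hA => by
      simp only [hrφ, add_zero]
      exact hφ.sum_pageRank_le_of_isUpperLevel hd hα hα1 hκ hε hε1 hν hS hp hνα hcond hA)
    (c := fun v => if v ∈ T then φ v else 0)
    (fun v => by split_ifs <;> simp [(hφ.2.1 v).le])
    (fun v => by split_ifs <;> simp [(hφ.2.1 v).le])
  simpa only [vol, mul_ite, mul_zero, hrφ, Finset.sum_ite_mem, Finset.univ_inter, add_zero] using h

end EDVWHypergraph

/-! ### Mass retained by a cluster. -/

namespace EDVWHypergraph

variable {V : Type*} [Fintype V] [DecidableEq V] {H : EDVWHypergraph V} {φ : V → ℝ}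

/-- With density at most `1 / vol C`, the outflow in a full step is at most `|∂C| / vol C`; laziness
halves it. -/
theorem sum_vecMul_lazyTransition_ge (hd : ∀ v, (H.incident v).Nonempty)
    {C : Finset V} {q : V → ℝ} (hq0 : ∀ v, 0 ≤ q v) (hq : ∀ v, q v ≤ φ v / vol φ C) :
    ∑ v ∈ C, q v - H.boundary φ C / vol φ C / 2 ≤ ∑ v ∈ C, (q ᵥ* H.lazyTransition) v := by
  simp only [EDVWHypergraph.vecMul_lazyTransition]
  rw [← Finset.mul_sum, Finset.sum_add_distrib]
  have hP : ∀ u v, 0 ≤ H.transition u v := H.transition_nonneg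
  have h1 : ∑ u ∈ C, ∑ v ∈ C, q u * H.transition u v ≤ ∑ v ∈ C, (q ᵥ* H.transition) v := by
    rw [Finset.sum_comm]
    exact Finset.sum_le_sum fun v _ => Finset.sum_le_sum_of_subset_of_nonneg
      (Finset.subset_univ _) fun u _ _ => mul_nonneg (hq0 u) (hP u v)
  have h2 : ∑ u ∈ C, ∑ v ∈ C, q u * H.transition u v +
      ∑ u ∈ C, ∑ v ∈ Cᶜ, q u * H.transition u v = ∑ u ∈ C, q u := by
    rw [← Finset.sum_add_distrib]
    refine Finset.sum_congr rfl fun u _ => ?_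
    rw [Finset.sum_add_sum_compl, ← Finset.mul_sum, H.sum_transition hd, mul_one]
  have h3 : ∑ u ∈ C, ∑ v ∈ Cᶜ, q u * H.transition u v ≤ H.boundary φ C / vol φ C := by
    rw [boundary, Finset.sum_div]
    refine Finset.sum_le_sum fun u _ => ?_
    rw [Finset.sum_div]
    refine Finset.sum_le_sum fun v _ => ?_
    rw [mul_div_right_comm]
    exact mul_le_mul_of_nonneg_right (hq u) (hP u v)
  linarith

/-- The left side is the closed form of `∑_{k<n} α (1 - α)^k (q(C) - k α / 2)`: the first `n` terms
of the PageRank series, with a loss of at most `α / 2` per step. Later terms are bounded below by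
zero. -/
theorem IsStationary.le_sum_pageRank (hφ : H.IsStationary φ) (hd : ∀ v, (H.incident v).Nonempty)
    {α : ℝ} (hα : 0 < α) (hα1 : α ≤ 1) {C : Finset V} (hC : H.boundary φ C / vol φ C = α) (n : ℕ) :
    ∀ {q p : V → ℝ}, (∀ v, 0 ≤ q v) → (∀ v, q v ≤ φ v / vol φ C) → (∀ v, 0 ≤ p v) →
      H.IsLazyPageRank α q p →
      ∑ v ∈ C, q v - (1 - α) / 2 +
        (1 - α) ^ n * (n * α / 2 + (1 - α) / 2 - ∑ v ∈ C, q v) ≤ ∑ v ∈ C, p v := by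
  induction n with
  | zero =>
    intro q p _ _ hp0 _
    have := Finset.sum_nonneg fun v (_ : v ∈ C) => hp0 v
    simp only [pow_zero, Nat.cast_zero]
    linarith
  | succ n ih =>
    intro q p hq0 hq hp0 hp
    have hM0 := H.lazyTransition_nonneg
    have h := ih (q := q ᵥ* H.lazyTransition) (p := p ᵥ* H.lazyTransition)
      (vecMul_nonneg_of_nonneg hM0 hq0)
      (fun v => by
        have h1 := vecMul_nonneg_of_nonneg hM0 (x := (vol φ C)⁻¹ • φ - q) (fun v => by
          have := hq v
          rw [div_eq_inv_mul] at this
          simp only [Pi.sub_apply, Pi.smul_apply, smul_eq_mul]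
          linarith) v
        rw [Matrix.sub_vecMul, Matrix.smul_vecMul, hφ.vecMul_lazyTransition] at h1
        simp only [Pi.sub_apply, Pi.smul_apply, smul_eq_mul] at h1
        rw [div_eq_inv_mul]
        linarith)
      (vecMul_nonneg_of_nonneg hM0 hp0)
      (by
        rw [IsLazyPageRank]
        conv_lhs => rw [hp]
        rw [Matrix.add_vecMul, Matrix.smul_vecMul, Matrix.smul_vecMul])
    have hb := sum_vecMul_lazyTransition_ge hd hq0 hq
    rw [hC] at hb
    have hpC : ∑ v ∈ C, p v = α * ∑ v ∈ C, q v +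
        (1 - α) * ∑ v ∈ C, (p ᵥ* H.lazyTransition) v := by
      conv_lhs => rw [hp]
      simp only [Pi.add_apply, Pi.smul_apply, smul_eq_mul, Finset.sum_add_distrib,
        ← Finset.mul_sum]
    set b := ∑ v ∈ C, q v
    set b' := ∑ v ∈ C, (q ᵥ* H.lazyTransition) v
    have hpow : (1 - α) ^ n ≤ 1 := pow_le_one₀ (by linarith) (by linarith)
    have h2 := mul_le_mul_of_nonneg_left hb (by linarith : 0 ≤ 1 - (1 - α) ^ n)
    have h3 : b - α / 2 - (1 - α) / 2 +
        (1 - α) ^ n * (n * α / 2 + (1 - α) / 2 - (b - α / 2)) ≤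
        ∑ v ∈ C, (p ᵥ* H.lazyTransition) v := by linarith
    have h4 := mul_le_mul_of_nonneg_left h3 (by linarith : 0 ≤ 1 - α)
    rw [hpC, pow_succ]
    push_cast
    linarith

/-- PageRank started from a cluster, with restart probability the conductance of the cluster,
retains more than half of its mass in the cluster, by a constant margin. -/
theorem IsStationary.half_lt_sum_pageRank (hφ : H.IsStationary φ)
    (hd : ∀ v, (H.incident v).Nonempty) {α : ℝ} (hα : 0 < α) (hα1 : α ≤ 1 / 4) {C : Finset V}
    (hC0 : C.Nonempty) (hC : H.boundary φ C / vol φ C = α) {p : V → ℝ}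
    (hp : H.IsLazyPageRank α (startDist φ C) p) : 1 / 2 + 1 / 512 ≤ ∑ v ∈ C, p v := by
  -- The bound `1 - k α / 2` turns negative at `k = 2 / α`. Truncating there gives a constant margin
  -- over `1/2`; the full series would give only `α / 2`.
  set n := ⌈2 / α⌉₊ with hn
  have h := hφ.le_sum_pageRank hd hα (by linarith) hC n (hφ.startDist_nonneg C)
    (hφ.startDist_le C) (pageRank_nonneg H.lazyTransition_nonneg (H.sum_lazyTransition hd) hα
      (by linarith) (hφ.startDist_nonneg C) hp) hp
  rw [hφ.sum_startDist_of_subset hC0 subset_rfl] at h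
  have hn1 : 2 ≤ n * α := by
    rw [← div_le_iff₀ hα]
    exact Nat.le_ceil _
  have hn2 : (n + 1) * α ≤ 2 + 2 * α := by
    have h1 : (n : ℝ) < 2 / α + 1 := Nat.ceil_lt_add_one (by positivity)
    have h2 := mul_lt_mul_of_pos_right h1 hα
    rw [add_mul, div_mul_cancel₀ _ hα.ne'] at h2
    linarith
  have hexp : Real.exp (-(2 * α)) ≤ 1 - α := by
    rw [Real.exp_neg, inv_le_comm₀ (Real.exp_pos _) (by linarith)]
    refine le_trans ?_ (Real.add_one_le_exp (2 * α))
    rw [inv_le_iff_one_le_mul₀ (by linarith)]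
    nlinarith
  -- Since `α ≤ 1/4`, the exponent `2 α (n + 1)` is at most `4 + 4 α ≤ 5`, and `e < 3`.
  have hpow : 1 / 243 ≤ (1 - α) ^ (n + 1) := by
    calc (1 : ℝ) / 243 = ((3 : ℝ) ^ 5)⁻¹ := by norm_num
      _ ≤ (Real.exp 1 ^ 5)⁻¹ := by
        refine inv_anti₀ (by positivity) (pow_le_pow_left₀ (Real.exp_pos _).le ?_ 5)
        linarith [Real.exp_one_lt_d9]
      _ = Real.exp (-5) := by
        rw [Real.exp_neg, ← Real.exp_nat_mul]
        norm_num
      _ ≤ Real.exp ((n + 1 : ℕ) * -(2 * α)) := by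
        refine Real.exp_le_exp.2 ?_
        push_cast
        linarith
      _ = Real.exp (-(2 * α)) ^ (n + 1) := Real.exp_nat_mul _ _
      _ ≤ (1 - α) ^ (n + 1) := pow_le_pow_left₀ (Real.exp_pos _).le hexp _
  have h5 : (1 - α) ^ n * ((1 - α) / 2) ≤
      (1 - α) ^ n * (n * α / 2 + (1 - α) / 2 - 1) :=
    mul_le_mul_of_nonneg_left (by linarith) (pow_nonneg (by linarith) _)
  rw [pow_succ] at hpow
  linarith

/-! ### Sweep cuts and outputs of the algorithm. -/

theorem IsSweepOrder.isSweepCut_of_isUpperLevel (hφ0 : ∀ v, 0 < φ v) {p : V → ℝ}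
    (hp0 : ∀ v, 0 ≤ p v) {l : List V} (hl : IsSweepOrder φ p l) {T : Finset V}
    (hT : IsUpperLevel (fun v => p v / φ v) T) (hT0 : T.Nonempty) (hT1 : T ≠ Finset.univ) :
    IsSweepCut l T := by
  obtain ⟨z, hz⟩ : ∃ z, z ∉ T := by
    by_contra! h
    exact hT1 (Finset.eq_univ_iff_forall.2 h)
  have hTl : ∀ v ∈ T, v ∈ l := fun v hv => by
    rw [hl.2.1]
    have h1 : p z / φ z < p v / φ v := hT v hv z hz
    have h2 : 0 ≤ p z / φ z := div_nonneg (hp0 z) (hφ0 z).le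
    exact (div_pos_iff_of_pos_right (hφ0 v)).1 (h2.trans_lt h1)
  -- Densities in `T` strictly exceed those outside, so `T` is a prefix of `l` however ties are
  -- ordered.
  set t := l.takeWhile (fun v => decide (v ∈ T)) with ht
  have hTt : ∀ v, v ∈ T ↔ v ∈ t := by
    intro v
    refine ⟨fun hv => ?_, fun hv => by simpa using List.mem_takeWhile_imp hv⟩
    have h1 := hTl v hv
    rw [← List.takeWhile_append_dropWhile (p := fun v => decide (v ∈ T)) (l := l),
      List.mem_append] at h1
    refine h1.resolve_right fun h2 => ?_
    have hpw : (l.dropWhile fun v => decide (v ∈ T)).Pairwise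
        (fun u v => p v / φ v ≤ p u / φ u) :=
      hl.2.2.sublist (List.dropWhile_sublist _)
    have hhead := List.head_dropWhile_not (fun v => decide (v ∈ T)) (l := l)
      (List.ne_nil_of_mem h2)
    cases hdw : l.dropWhile (fun v => decide (v ∈ T)) with
    | nil => simp [hdw] at h2
    | cons w s =>
      simp only [hdw, List.head_cons, decide_eq_false_iff_not] at hhead
      rw [hdw] at h2 hpw
      rcases List.mem_cons.1 h2 with rfl | h2
      · exact hhead hv
      · exact absurd (hT v hv w hhead) (not_lt.2 ((List.pairwise_cons.1 hpw).1 v h2))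
  obtain ⟨v, hv⟩ := hT0
  have hpre : t <+: l := List.takeWhile_prefix _
  refine ⟨hT1, t.length, List.length_pos_of_mem ((hTt v).1 hv), hpre.length_le, ?_⟩
  rw [← List.prefix_iff_eq_take.1 hpre]
  ext u
  rw [hTt, List.mem_toFinset]

theorem IsSweepCut.nonempty {l : List V} {T : Finset V} (hT : IsSweepCut l T) : T.Nonempty := by
  obtain ⟨-, j, hj, hjl, rfl⟩ := hT
  rw [List.toFinset_nonempty_iff]
  intro h
  have := congrArg List.length h
  simp only [List.length_take, List.length_nil] at this
  omega

theorem exists_isSweepOrder {V : Type*} [Fintype V] (φ p : V → ℝ) : ∃ l, IsSweepOrder φ p l := by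
  classical
  have hperm := List.perm_insertionSort (fun u v => p v / φ v ≤ p u / φ u)
    (Finset.univ.filter fun v => 0 < p v).toList
  refine ⟨_, hperm.nodup_iff.2 (Finset.nodup_toList _), fun v => ?_, ?_⟩
  · rw [hperm.mem_iff]
    simp
  · have : Std.Total fun u v => p v / φ v ≤ p u / φ u := ⟨fun u v => le_total _ _⟩
    have : IsTrans V fun u v => p v / φ v ≤ p u / φ u := ⟨fun u v w h1 h2 => h2.trans h1⟩
    exact List.pairwise_insertionSort _ _

theorem IsStationary.exists_isHyperACLOutput [Nontrivial V] (hφ : H.IsStationary φ)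
    (hd : ∀ v, (H.incident v).Nonempty) {α : ℝ} (hα : 0 < α) (hα1 : α ≤ 1) {S : Finset V}
    (hS : S.Nonempty) : ∃ T, H.IsHyperACLOutput φ α S T := by
  classical
  obtain ⟨p, hp⟩ := exists_pageRank H.lazyTransition_nonneg (H.sum_lazyTransition hd) hα hα1
    (startDist φ S)
  obtain ⟨l, hl⟩ := exists_isSweepOrder φ p
  have hp1 : ∑ v, p v = 1 := (sum_pageRank (H.sum_lazyTransition hd) hα hp).trans
    (hφ.sum_startDist_of_subset hS (Finset.subset_univ _))
  obtain ⟨v, -, hv⟩ := Finset.exists_lt_of_sum_lt (s := Finset.univ) (f := fun _ => (0 : ℝ))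
    (g := p) (by rw [hp1]; simp)
  have hvl := (hl.2.1 v).2 hv
  have hlen : 1 ≤ l.length := List.length_pos_of_mem hvl
  have hcut : IsSweepCut l (l.take 1).toFinset := by
    refine ⟨fun h => ?_, 1, le_rfl, hlen, rfl⟩
    have h1 := List.toFinset_card_le (l.take 1)
    rw [h, Finset.card_univ, List.length_take] at h1
    have h2 := Fintype.one_lt_card (α := V)
    omega
  obtain ⟨T, hT, hmin⟩ := Finset.exists_min_image (Finset.univ.filter fun T => IsSweepCut l T)
    (H.conductance φ) ⟨_, Finset.mem_filter.2 ⟨Finset.mem_univ _, hcut⟩⟩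
  exact ⟨T, p, l, hp, hl, (Finset.mem_filter.1 hT).2,
    fun T' hT' => hmin T' (Finset.mem_filter.2 ⟨Finset.mem_univ _, hT'⟩)⟩

theorem IsStationary.conductance_lt_of_isHyperACLOutput (hφ : H.IsStationary φ)
    (hd : ∀ v, (H.incident v).Nonempty) {α : ℝ} (hα : 0 < α) (hα1 : α ≤ 1) {S C : Finset V}
    (hS : S.Nonempty) (hC0 : C.Nonempty) (hC : vol φ C ≤ 1 / 2)
    (hSC : vol φ C / 1024 ≤ vol φ S) {p : V → ℝ} (hp : H.IsLazyPageRank α (startDist φ S) p)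
    (hpC : 1 / 2 + 1 / 1024 ≤ ∑ v ∈ C, p v) {T : Finset V} (hT : H.IsHyperACLOutput φ α S T) :
    H.conductance φ T < 2 ^ 26 * √α := by
  obtain ⟨q, l, hq, hl, -, hmin⟩ := hT
  obtain rfl := pageRank_unique H.lazyTransition_nonneg (H.sum_lazyTransition hd) hα hα1 hp hq
  have hp0 := pageRank_nonneg H.lazyTransition_nonneg (H.sum_lazyTransition hd) hα hα1
    (hφ.startDist_nonneg S) hp
  by_contra! hle
  have hvC := hφ.vol_pos hC0
  have hsC : 0 < √(vol φ C) := Real.sqrt_pos.2 hvC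
  have hsq : √(vol φ C) * (1 / 2) ^ 12 ≤ √((1 / 2) ^ 12 * vol φ S) := by
    refine Real.le_sqrt_of_sq_le ?_
    rw [mul_pow, Real.sq_sqrt hvC.le]
    linarith
  -- `ε` and `ν * √(vol C)` both equal `2⁻¹²`, so their sum `1/2048` stays below the margin
  -- `1/1024`. The exponent 26 makes `ν (κ ε)² * 2⁻¹² √(vol C)` equal to `16 α`.
  have h := hφ.sum_pageRank_le hd hα hα1 (κ := 2 ^ 26 * √α) (ε := (1 / 2) ^ 12)
    (ν := (1 / 2) ^ 12 / √(vol φ C)) (by positivity) (by positivity) (by norm_num)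
    (by positivity) hS hp ?_ (fun A hA hA0 hA1 => ?_) C
  · rw [div_mul_cancel₀ _ hsC.ne'] at h
    linarith
  · calc 8 * α < 16 * α := by linarith
      _ = (1 / 2) ^ 12 / √(vol φ C) * (2 ^ 26 * √α * (1 / 2) ^ 12) ^ 2 *
          (√(vol φ C) * (1 / 2) ^ 12) := by
        rw [mul_pow, mul_pow, Real.sq_sqrt hα.le]
        field_simp
        norm_num
      _ ≤ _ := mul_le_mul_of_nonneg_left hsq (by positivity)
  · have h1 := hle.trans (hmin A (hl.isSweepCut_of_isUpperLevel hφ.2.1 hp0 hA hA0 hA1))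
    rwa [conductance, le_div_iff₀ (hφ.min_vol_pos hA0 hA1)] at h1

/-! ### A cluster split into two seed sets. -/

theorem exists_large_part_of_convex_combination {a b x y η : ℝ} (hη : 0 < η) (hη1 : η ≤ 1)
    (ha : 0 ≤ a) (hb : 0 ≤ b) (hab : a + b = 1) (hx : x ≤ 1) (hy : y ≤ 1)
    (h : 1 / 2 + η ≤ a * x + b * y) :
    (η / 2 ≤ a ∧ 1 / 2 + η / 2 ≤ x) ∨ (η / 2 ≤ b ∧ 1 / 2 + η / 2 ≤ y) := by
  by_contra! hcon
  obtain ⟨h1, h2⟩ := hcon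
  by_cases hA : η / 2 ≤ a
  · have h3 := h1 hA
    by_cases hB : η / 2 ≤ b
    · have h4 := h2 hB
      nlinarith
    · nlinarith
  · by_cases hB : η / 2 ≤ b
    · have h4 := h2 hB
      nlinarith
    · nlinarith

/-- Of the two parts of a cluster, at least one is a good seed set for it. -/
theorem IsStationary.hyperACLSucceeds_or [Nontrivial V] (hφ : H.IsStationary φ)
    (hc : H.Connected) {star : Finset V → Finset V} {A B C : Finset V} (hAB : Disjoint A B)
    (hC : A ∪ B = C) (hC0 : C.Nonempty) (hC1 : C ≠ Finset.univ) (hCv : vol φ C ≤ 1 / 2)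
    (hA : star A = C) (hB : star B = C) :
    H.HyperACLSucceeds φ star (2 ^ 26) A ∨ H.HyperACLSucceeds φ star (2 ^ 26) B := by
  have hd := hc.incident_nonempty
  set α := H.conductance φ C with hαdef
  have hα : 0 < α := hφ.conductance_pos hc hC0 hC1
  have hα1 : α ≤ 1 := hφ.conductance_le_one hd hC0 hC1
  have hvC := hφ.vol_pos hC0
  simp only [HyperACLSucceeds, hA, hB, ← hαdef]
  -- For large `α` the bound is trivial because conductance is at most one; only a nonempty seed is
  -- needed.
  by_cases hlarge : 1 < 2 ^ 26 * √α
  · have key : ∀ S : Finset V, S.Nonempty → (∃ T, H.IsHyperACLOutput φ α S T) ∧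
        ∀ T, H.IsHyperACLOutput φ α S T → H.conductance φ T < 2 ^ 26 * √α := by
      refine fun S hS => ⟨hφ.exists_isHyperACLOutput hd hα hα1 hS, fun T hT => ?_⟩
      obtain ⟨-, l, -, -, hcut, -⟩ := hT
      exact (hφ.conductance_le_one hd hcut.nonempty hcut.1).trans_lt hlarge
    rw [← hC, Finset.union_nonempty] at hC0
    exact hC0.imp (key A) (key B)
  have hα4 : α ≤ 1 / 4 := by
    have h1 : √α ≤ 1 / 2 := by linarith [Real.sqrt_nonneg α]
    have h2 := (Real.sqrt_le_left (by norm_num)).1 h1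
    linarith
  have hbd : H.boundary φ C / vol φ C = α := by
    rw [hαdef, conductance, min_eq_left (by linarith)]
  have hM0 := H.lazyTransition_nonneg
  have hM1 := H.sum_lazyTransition hd
  obtain ⟨p, hp⟩ := exists_pageRank hM0 hM1 hα hα1 (startDist φ A)
  obtain ⟨q, hq⟩ := exists_pageRank hM0 hM1 hα hα1 (startDist φ B)
  have hsum_le : ∀ (S : Finset V) (x : V → ℝ), H.IsLazyPageRank α (startDist φ S) x →
      ∑ v ∈ C, x v ≤ 1 := by
    intro S x hx
    have hx0 := pageRank_nonneg hM0 hM1 hα hα1 (hφ.startDist_nonneg S) hx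
    refine (Finset.sum_le_sum_of_subset_of_nonneg (Finset.subset_univ _)
      fun v _ _ => hx0 v).trans ?_
    rw [sum_pageRank hM1 hα hx]
    -- One part may be empty; its start vector is then zero and has weight zero in the combination.
    rcases S.eq_empty_or_nonempty with rfl | hS
    · simp [startDist]
    · exact (hφ.sum_startDist_of_subset hS (Finset.subset_univ _)).le
  have hvol : vol φ A + vol φ B = vol φ C := by
    rw [← hC]
    exact (Finset.sum_union hAB).symm
  set a := vol φ A / vol φ C with ha
  set b := vol φ B / vol φ C with hb
  have hmul : ∀ (S : Finset V) (v : V), vol φ S / vol φ C * startDist φ S v =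
      if v ∈ S then φ v / vol φ C else 0 := by
    intro S v
    rw [startDist]
    split_ifs with hv
    · have := (hφ.vol_pos ⟨v, hv⟩).ne'
      field_simp
    · simp
  have hstart : a • startDist φ A + b • startDist φ B = startDist φ C := by
    funext v
    simp only [Pi.add_apply, Pi.smul_apply, smul_eq_mul, ha, hb, hmul]
    rw [startDist]
    have h1 : v ∈ A → v ∉ B := fun h => Finset.disjoint_left.1 hAB h
    by_cases hvA : v ∈ A
    · simp [← hC, hvA, h1 hvA]
    · by_cases hvB : v ∈ B <;> simp [← hC, hvA, hvB]
  have hcomb : H.IsLazyPageRank α (startDist φ C) (a • p + b • q) := by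
    rw [IsLazyPageRank, ← hstart, Matrix.add_vecMul, Matrix.smul_vecMul, Matrix.smul_vecMul]
    conv_lhs => rw [hp, hq]
    module
  have hhalf := hφ.half_lt_sum_pageRank hd hα hα4 hC0 hbd hcomb
  simp only [Pi.add_apply, Pi.smul_apply, smul_eq_mul, Finset.sum_add_distrib,
    ← Finset.mul_sum] at hhalf
  have key : ∀ (S : Finset V) (x : V → ℝ), H.IsLazyPageRank α (startDist φ S) x →
      1 / 512 / 2 ≤ vol φ S / vol φ C → 1 / 2 + 1 / 512 / 2 ≤ ∑ v ∈ C, x v →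
      (∃ T, H.IsHyperACLOutput φ α S T) ∧
        ∀ T, H.IsHyperACLOutput φ α S T → H.conductance φ T < 2 ^ 26 * √α := by
    intro S x hx h1 h2
    rw [le_div_iff₀ hvC] at h1
    have hS : S.Nonempty := by
      rw [Finset.nonempty_iff_ne_empty]
      rintro rfl
      simp only [vol, Finset.sum_empty] at h1 hvC
      linarith
    exact ⟨hφ.exists_isHyperACLOutput hd hα hα1 hS, fun T hT =>
      hφ.conductance_lt_of_isHyperACLOutput hd hα hα1 hS hC0 hCv (by linarith) hx
        (by linarith) hT⟩
  rcases exists_large_part_of_convex_combination (by norm_num) (by norm_num)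
    (div_nonneg (hφ.vol_nonneg A) hvC.le) (div_nonneg (hφ.vol_nonneg B) hvC.le)
    (by rw [← add_div, hvol, div_self hvC.ne']) (hsum_le A p hp) (hsum_le B q hq) hhalf
    with ⟨h1, h2⟩ | ⟨h1, h2⟩
  · exact Or.inl (key A p hp h1 h2)
  · exact Or.inr (key B q hq h1 h2)

end EDVWHypergraph

/-! ### Counting by an involution, and the conclusion. -/

theorem half_le_uniformSubsetProb_div {V : Type*} [Fintype V] {P Q : Finset V → Prop}
    (i : Finset V → Finset V) (hiP : ∀ S, P S → P (i S)) (hi : ∀ S, P S → i (i S) = S)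
    (hQ : ∀ S, P S → Q S ∨ Q (i S)) (hP : 0 < uniformSubsetProb V P) :
    1 / 2 ≤ uniformSubsetProb V (fun S => P S ∧ Q S) / uniformSubsetProb V P := by
  classical
  have hprob : ∀ A : Finset V → Prop, ∀ _ : DecidablePred A,
      uniformSubsetProb V A = (Finset.univ.filter A).card / (Fintype.card (Finset V) : ℝ) :=
    fun A _ => by
      simp only [uniformSubsetProb]
      congr
  rw [le_div_iff₀ hP, hprob P inferInstance, hprob _ inferInstance, ← mul_div_assoc]
  refine div_le_div_of_nonneg_right ?_ (Nat.cast_nonneg _)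
  have hcard : (Finset.univ.filter fun S => P S ∧ ¬ Q S).card ≤
      (Finset.univ.filter fun S => P S ∧ Q S).card := by
    -- The partner of a failure is a success, and an involution is injective.
    refine Finset.card_le_card_of_injOn i (fun S hS => ?_) fun S hS T hT h => ?_
    · have h := (Finset.mem_filter.1 (Finset.mem_coe.1 hS)).2
      exact Finset.mem_coe.2 (Finset.mem_filter.2
        ⟨Finset.mem_univ _, hiP S h.1, (hQ S h.1).resolve_left h.2⟩)
    · rw [← hi S (Finset.mem_filter.1 (Finset.mem_coe.1 hS)).2.1, h,
        hi T (Finset.mem_filter.1 (Finset.mem_coe.1 hT)).2.1]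
  have hsplit := Finset.card_filter_add_card_filter_not (s := Finset.univ.filter P) Q
  rw [Finset.filter_filter, Finset.filter_filter] at hsplit
  have h2 : (Finset.univ.filter P).card ≤ 2 * (Finset.univ.filter fun S => P S ∧ Q S).card := by
    omega
  have h3 : ((Finset.univ.filter P).card : ℝ) ≤
      2 * (Finset.univ.filter fun S => P S ∧ Q S).card := by exact_mod_cast h2
  linarith

theorem theorem2 :
    ∃ K : ℝ, 0 < K ∧
      ∀ (V : Type*) [Fintype V] [DecidableEq V] (H : EDVWHypergraph V) (φ : V → ℝ)
        (star : Finset V → Finset V),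
        H.Connected → H.IsStationary φ →
        (∀ S : Finset V, S ≠ Finset.univ → H.IsOptimalCluster φ S (star S)) →
        0 < uniformSubsetProb V (EDVWHypergraph.SeedCondition φ star) →
        1 / 2 ≤
          uniformSubsetProb V (fun S => EDVWHypergraph.SeedCondition φ star S ∧
              H.HyperACLSucceeds φ star K S) /
            uniformSubsetProb V (EDVWHypergraph.SeedCondition φ star) := by
  refine ⟨2 ^ 26, by norm_num, ?_⟩
  intro V _ _ H φ star hc hφ hstar hpos
  have hsub : ∀ S, EDVWHypergraph.SeedCondition φ star S → star S \ (star S \ S) = S :=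
    fun S hS => by
      rw [sdiff_sdiff_right_self]
      exact Finset.inter_eq_right.2 (hstar S hS.1).1
  -- By condition (2) both partners have the same optimal cluster, so taking the complement within
  -- it twice gives back `S`.
  refine half_le_uniformSubsetProb_div (fun S => star S \ S) (fun S hS => ?_) (fun S hS => ?_)
    (fun S hS => ?_) hpos
  · obtain ⟨h1, h2, h3⟩ := hS
    refine ⟨fun h => (hstar S h1).2.2.1 ?_, by rwa [h3], ?_⟩
    · exact Finset.univ_subset_iff.1 (h ▸ Finset.sdiff_subset)
    · rw [h3, hsub S ⟨h1, h2, h3⟩]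
  · rw [hS.2.2, hsub S hS]
  · obtain ⟨hSC, hC0, hC1, -⟩ := hstar S hS.1
    have : Nontrivial V := by
      obtain ⟨u, hu⟩ := hC0
      obtain ⟨v, hv⟩ : ∃ v, v ∉ star S := by
        by_contra! h
        exact hC1 (Finset.eq_univ_iff_forall.2 h)
      exact ⟨u, v, fun h => hv (h ▸ hu)⟩
    exact hφ.hyperACLSucceeds_or hc Finset.disjoint_sdiff
      (Finset.union_sdiff_of_subset hSC) hC0 hC1 hS.2.1 rfl hS.2.2
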